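/- Let $M=\mathbb R^2/\Gamma$ ($\Gamma$ any lattice) be a flat $2$-torus with the metric induced by the Euclidean one, and write points of its unit tangent bundle $SM=M\times\mathbb R/2\pi\mathbb Z$ as $(x,\theta)$, standing for the unit vector $(\cos\theta,\sin\theta)$ at $x$. Let $X$ be the geodesic vector field, $V=\partial_\theta$, $H=[V,X]$, and let $(\alpha,\beta,\psi)$ be the coframe dual to $(X,H,V)$. Let $\lambda(x,\theta)=\cos\theta$, $F=X+\lambda V$, $\psi_\lambda=\psi-\lambda\alpha$, $\Sigma(v)=\{\xi\in T_v^*SM:\xi(F(v))=0\}$, $\mathbb H^*(v)=\mathbb R\beta(v)$, and let $\mathbb K=\pi^*K_g-H(\lambda)+\lambda^2+F(V(\lambda))$ be the thermostat curvature, where $K_g$ is the Gaussian curvature and $\pi:SM\to M$ the projection. Then: 1. $\mathbb K=0$ on all of $SM$. 2. The vector field $F$ has a unique complete flow $(\varphi_t)_{t\in\mathbb R}$, and $d\varphi_t^{-\top}(\mathbb H^*(v))\neq\mathbb H^*(\varphi_t(v))$ for all $v\in SM$ and all $t\ne0$. 3. For every $x\in M$ and $v=(x,\pm\pi/2)$,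 the limits defining the Green bundles at $v$, $$G_s^*(v)=\lim_{t\to\infty}d\varphi_{-t}^{-\top}\big(\mathbb H^*(\varphi_t(v))\big),\qquad G_u^*(v)=\lim_{t\to\infty}d\varphi_{t}^{-\top}\big(\mathbb H^*(\varphi_{-t}(v))\big),$$ exist in the projectivization of $\Sigma(v)$, and $$G_s^*(x,\pi/2)=\mathbb R(\psi_\lambda+\beta),\qquad G_u^*(x,\pi/2)=\mathbb R\psi_\lambda,$$ $$G_s^*(x,-\pi/2)=\mathbb R\psi_\lambda,\qquad G_u^*(x,-\pi/2)=\mathbb R(\psi_\lambda-\beta).$$ 4. In particular, $G_s^*(v)\cap G_u^*(v)=\{0\}$ for every $v=(x,\pm\pi/2)$. Thus vanishing thermostat curvature does not force the stable and unstable Green bundles to coincide everywhere. -/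

import Mathlib

open Filter Topology
open scoped LinearAlgebra.Projectivization RealInnerProductSpace

noncomputable section

namespace FlatThermostat

/-- The oriented Euclidean plane. -/
abbrev Plane : Type := EuclideanSpace ℝ (Fin 2)

/-- The flat torus `ℝ² / Γ`, with the metric induced by the Euclidean metric (`Γ` a lattice). -/
abbrev Torus (Γ : Submodule ℤ Plane) : Type := Plane ⧸ Γ

/-- The unit tangent bundle of the flat torus: `(x, θ)` stands for the unit tangent vector
`(cos θ, sin θ)` at `x`, where `θ` is an angle modulo `2π`. -/
abbrev UnitTangent (Γ : Submodule ℤ Plane) : Type := Torus Γ × Real.Angle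

/-- The tangent space of the unit tangent bundle at any of its points: the bundle is the quotient
of `ℝ² × ℝ` by the group of translations `Γ × 2πℤ`, so its tangent bundle is canonically
trivial. -/
abbrev TanVec : Type := Plane × ℝ

/-- The cotangent space of the unit tangent bundle at any of its points. -/
abbrev CoVec : Type := TanVec →L[ℝ] ℝ

variable {Γ : Submodule ℤ Plane}

/-- The universal covering `ℝ² × ℝ → (ℝ² / Γ) × (ℝ / 2πℤ)`. -/
def cover (Γ : Submodule ℤ Plane) (h : TanVec) : UnitTangent Γ :=
  (Submodule.Quotient.mk h.1, (h.2 : Real.Angle))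

/-! ### Calculus on the unit tangent bundle

The maps `h ↦ v + cover Γ h` are the flat local parametrizations centred at `v`. -/

/-- The differential at `v` of a real function on the unit tangent bundle, applied to `w`. -/
def dirDeriv (u : UnitTangent Γ → ℝ) (v : UnitTangent Γ) (w : TanVec) : ℝ :=
  fderiv ℝ (fun h : TanVec => u (v + cover Γ h)) 0 w

/-- The derivative `Y(u)` of a function `u` along a vector field `Y`. -/
def along (Y : UnitTangent Γ → TanVec) (u : UnitTangent Γ → ℝ) (v : UnitTangent Γ) : ℝ :=
  dirDeriv u v (Y v)

/-- The Lie bracket `[Y, Z]` of vector fields on the unit tangent bundle. -/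
def bracket (Y Z : UnitTangent Γ → TanVec) (v : UnitTangent Γ) : TanVec :=
  VectorField.lieBracket ℝ (fun h : TanVec => Y (v + cover Γ h))
    (fun h : TanVec => Z (v + cover Γ h)) 0

/-- `A` is the differential at `v` of a self-map `f` of the unit tangent bundle: near `v`, the map
`f` is given in flat coordinates by a map `L` with derivative `A`. -/
def HasDifferentialAt (f : UnitTangent Γ → UnitTangent Γ) (A : TanVec →L[ℝ] TanVec)
    (v : UnitTangent Γ) : Prop :=
  ∃ L : TanVec → TanVec, L 0 = 0 ∧
    (∀ᶠ h in 𝓝 (0 : TanVec), f (v + cover Γ h) = f v + cover Γ (L h)) ∧ HasFDerivAt L A 0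

open Classical in
/-- The differential `df(v)` (and `0` if `f` is not differentiable at `v`). -/
def differential (f : UnitTangent Γ → UnitTangent Γ) (v : UnitTangent Γ) :
    TanVec →L[ℝ] TanVec :=
  if h : ∃ A, HasDifferentialAt f A v then h.choose else 0

/-- The inverse transpose `df(v)^{-⊤} : T*_v → T*_{f(v)}`, that is, `ξ ↦ ξ ∘ df(v)⁻¹`. -/
def invTranspose (f : UnitTangent Γ → UnitTangent Γ) (v : UnitTangent Γ) : CoVec →ₗ[ℝ] CoVec where
  toFun ξ := ξ.comp (differential f v).inverse
  map_add' _ _ := rfl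
  map_smul' _ _ := rfl

/-- `γ` is an integral curve of the vector field `Y`, expressed through a lift `c` of `γ` to the
universal cover. -/
def IsIntegralCurve (Y : UnitTangent Γ → TanVec) (γ : ℝ → UnitTangent Γ) : Prop :=
  ∃ c : ℝ → TanVec, (∀ t, cover Γ (c t) = γ t) ∧ ∀ t, HasDerivAt c (Y (γ t)) t

/-- `φ` is the (complete) flow of the vector field `Y`. -/
def IsFlow (Y : UnitTangent Γ → TanVec) (φ : ℝ → UnitTangent Γ → UnitTangent Γ) : Prop :=
  ∀ v, φ 0 v = v ∧ IsIntegralCurve Y (fun t => φ t v)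

/-! ### The moving frame and coframe -/

/-- The unit vector `(cos θ, sin θ)`. -/
def unitVec (θ : Real.Angle) : Plane := !₂[θ.cos, θ.sin]

/-- The unit vector `(cos θ, sin θ)` rotated by `J`, i.e. by `π / 2`. -/
def rotVec (θ : Real.Angle) : Plane := !₂[-θ.sin, θ.cos]

/-- The geodesic vector field: its integral curves are `t ↦ (x + t (cos θ, sin θ), θ)`. -/
def geodesicField (v : UnitTangent Γ) : TanVec := (unitVec v.2, 0)

/-- The vertical vector field `∂_θ`. -/
def verticalField (_ : UnitTangent Γ) : TanVec := (0, 1)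

/-- The horizontal vector field `H = [V, X]`. -/
def horizontalField : UnitTangent Γ → TanVec := bracket verticalField geodesicField

theorem hasFDerivAt_unitVec (v : UnitTangent Γ) :
    HasFDerivAt (fun h : TanVec => unitVec (v + cover Γ h).2)
      ((ContinuousLinearMap.snd ℝ Plane ℝ).smulRight (rotVec v.2)) 0 := by
  obtain ⟨x, θ⟩ := v
  induction θ using Real.Angle.induction_on with
  | _ θ =>
  have h1 : ∀ h : TanVec, unitVec ((x, (θ : Real.Angle)) + cover Γ h : UnitTangent Γ).2
      = !₂[Real.cos (θ + h.2), Real.sin (θ + h.2)] := by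
    intro h
    simp [unitVec, cover, ← Real.Angle.coe_add]
  simp only [h1]
  rw [← hasFDerivWithinAt_univ, hasFDerivWithinAt_euclidean]
  intro i
  rw [hasFDerivWithinAt_univ]
  have h2 : HasFDerivAt (fun h : TanVec => θ + h.2) (ContinuousLinearMap.snd ℝ Plane ℝ) 0 :=
    (hasFDerivAt_snd).const_add θ
  fin_cases i
  · refine (h2.cos).congr_fderiv ?_
    ext <;> simp [rotVec]
  · refine (h2.sin).congr_fderiv ?_
    ext <;> simp [rotVec]

theorem horizontalField_eq (v : UnitTangent Γ) : horizontalField v = (rotVec v.2, 0) := by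
  unfold horizontalField bracket VectorField.lieBracket
  have h := (hasFDerivAt_unitVec v).prodMk (hasFDerivAt_const (0 : ℝ) (0 : TanVec))
  simp only [geodesicField, verticalField]
  rw [h.fderiv]
  simp

/-- The covector `α` of the coframe `(α, β, ψ)` dual to `(X, H, V)`. -/
def coAlpha (v : UnitTangent Γ) : CoVec :=
  (innerSL ℝ (unitVec v.2)).comp (ContinuousLinearMap.fst ℝ Plane ℝ)

/-- The covector `β` of the coframe `(α, β, ψ)` dual to `(X, H, V)`. -/
def coBeta (v : UnitTangent Γ) : CoVec :=
  (innerSL ℝ (rotVec v.2)).comp (ContinuousLinearMap.fst ℝ Plane ℝ)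

/-- The covector `ψ` of the coframe `(α, β, ψ)` dual to `(X, H, V)`. -/
def coPsi (_ : UnitTangent Γ) : CoVec := ContinuousLinearMap.snd ℝ Plane ℝ

/-- The coframe `(α, β, ψ)` is dual to the frame `(X, H, V)`. -/
theorem coframe_dual (v : UnitTangent Γ) :
    (coAlpha v (geodesicField v) = 1 ∧ coAlpha v (horizontalField v) = 0 ∧
      coAlpha v (verticalField v) = 0) ∧
    (coBeta v (geodesicField v) = 0 ∧ coBeta v (horizontalField v) = 1 ∧
      coBeta v (verticalField v) = 0) ∧
    (coPsi v (geodesicField v) = 0 ∧ coPsi v (horizontalField v) = 0 ∧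
      coPsi v (verticalField v) = 1) := by
  rw [horizontalField_eq]
  have := v.2.cos_sq_add_sin_sq
  simp [coBeta, coAlpha, coPsi, geodesicField, verticalField, unitVec, rotVec,
    PiLp.inner_apply, Fin.sum_univ_two]
  simp [EuclideanSpace.norm_eq, Fin.sum_univ_two, this, add_comm (v.2.sin ^ 2)]
  refine ⟨?_, ?_⟩ <;> ring

/-- The pullback to the unit tangent bundle of the Gaussian curvature `K` of the metric, read off
from the structure equation `[X, H] = K V`. -/
def gaussCurvature (v : UnitTangent Γ) : ℝ := coPsi v (bracket geodesicField horizontalField v)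

/-! ### Thermostats -/

/-- The generator `F = X + λ V` of the thermostat flow. -/
def thermostatField (lam : UnitTangent Γ → ℝ) (v : UnitTangent Γ) : TanVec :=
  geodesicField v + lam v • verticalField v

/-- The thermostat curvature `K - H(λ) + λ² + F(V(λ))`. -/
def thermostatCurvature (lam : UnitTangent Γ → ℝ) (v : UnitTangent Γ) : ℝ :=
  gaussCurvature v - along horizontalField lam v + lam v ^ 2
    + along (thermostatField lam) (along verticalField lam) v

/-- The covector `ψ_λ = ψ - λ α`. -/
def coPsiLam (lam : UnitTangent Γ → ℝ) (v : UnitTangent Γ) : CoVec := coPsi v - lam v • coAlpha v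

/-- The fibre `Σ(v) = {ξ | ξ(F(v)) = 0}` of the characteristic set. -/
def charSet (lam : UnitTangent Γ → ℝ) (v : UnitTangent Γ) : Submodule ℝ CoVec where
  carrier := {ξ | ξ (thermostatField lam v) = 0}
  add_mem' := by
    intro ξ η hξ hη
    simp only [Set.mem_ofPred_eq] at hξ hη ⊢
    simp [hξ, hη]
  zero_mem' := by simp
  smul_mem' := by
    intro c ξ hξ
    simp only [Set.mem_ofPred_eq] at hξ ⊢
    simp [hξ]

/-- The line `ℝ ξ`. -/
def line (ξ : CoVec) : Submodule ℝ CoVec := Submodule.span ℝ {ξ}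

/-- The cohorizontal line `ℍ*(v) = ℝ β`. -/
def cohorizontal (v : UnitTangent Γ) : Submodule ℝ CoVec := line (coBeta v)

/-- The usual (quotient) topology on the projectivization of a real topological vector space. -/
instance projTopology (W : Type*) [AddCommGroup W] [Module ℝ W] [TopologicalSpace W] :
    TopologicalSpace (ℙ ℝ W) :=
  inferInstanceAs (TopologicalSpace (Quotient (projectivizationSetoid ℝ W)))

/-- The family `t ↦ L t` consists of lines in the subspace `S`, and converges to the line `G`, in
the projectivization of `S`, as `t → ∞`. -/
def LinesTendsto (S : Submodule ℝ CoVec) (L : ℝ → Submodule ℝ CoVec) (G : Submodule ℝ CoVec) :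
    Prop :=
  ∃ (l : ℝ → ℙ ℝ S) (g : ℙ ℝ S), (∀ t, (l t).submodule.map S.subtype = L t) ∧
    g.submodule.map S.subtype = G ∧ Tendsto l atTop (𝓝 g)

/-- `G` is the stable Green line at `v` of the thermostat with flow `φ`: the limit, as `t → ∞`, of
`dφ_{-t}^{-⊤}(ℍ*(φ_t(v)))`. -/
def IsStableGreen (lam : UnitTangent Γ → ℝ) (φ : ℝ → UnitTangent Γ → UnitTangent Γ)
    (v : UnitTangent Γ) (G : Submodule ℝ CoVec) : Prop :=
  LinesTendsto (charSet lam v)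
    (fun t => (cohorizontal (φ t v)).map (invTranspose (φ (-t)) (φ t v))) G

/-- `G` is the unstable Green line at `v` of the thermostat with flow `φ`: the limit, as `t → ∞`,
of `dφ_t^{-⊤}(ℍ*(φ_{-t}(v)))`. -/
def IsUnstableGreen (lam : UnitTangent Γ → ℝ) (φ : ℝ → UnitTangent Γ → UnitTangent Γ)
    (v : UnitTangent Γ) (G : Submodule ℝ CoVec) : Prop :=
  LinesTendsto (charSet lam v)
    (fun t => (cohorizontal (φ (-t) v)).map (invTranspose (φ t) (φ (-t) v))) G

/-- The function `λ(x, θ) = cos θ`. -/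
def cosLam (Γ : Submodule ℤ Plane) (v : UnitTangent Γ) : ℝ := v.2.cos

end FlatThermostat

end

open FlatThermostat

/-!
The lift of `F = X + cos θ V` to `ℝ² × ℝ` is the system `x' = cos θ`, `y' = sin θ`, `θ' = cos θ`,
which has a closed-form solution. With `D = cosh t + sin θ sinh t > 0` one has
`cos θ_t = cos θ / D`, `sin θ_t = (sinh t + sin θ cosh t) / D`, and the turning angle
`δ = θ_t - θ = 2 arctan (cos θ sinh (t/2) / (cosh (t/2) + sin θ sinh (t/2)))` is a globally smooth
function, so that `φ_t (x, y, θ) = (x + δ, y + log D, θ + δ)` (`isFlow_explicitFlow`). The lifted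
field is Lipschitz, whence uniqueness (`IsFlow.eq_explicitFlow`).

In the flat trivialization `dφ_t` is the identity plus a rank-one map whose entries are
`∂δ/∂θ = 1/D - 1` and `∂(log D)/∂θ = cos θ sinh t / D`. Inverting it gives
`dφ_t^{-⊤} β = β - (sin θ (cosh t - 1) + sinh t) ψ` (`invTranspose_explicitFlow_coBeta`), where `β`
and `ψ` are written in the translation-invariant trivialization of the cotangent bundle. The
coefficient of `ψ` is `2 sinh (t/2) (cosh (t/2) + sin θ sinh (t/2))`, which vanishes only at
`t = 0`: this is the twist property.

The vertical directions `θ = ±π/2` are invariant under the flow, and there the coefficient is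
`±(e^{±t} - 1)`; hence it either converges or diverges as `t → ∞`, which gives the Green lines
(`linesTendsto_charSet_iff`). That a family of lines has at most one limit rests on the projective
space being Hausdorff (`t2Space_projectivization`).
-/

namespace FlatThermostat

variable {Γ : Submodule ℤ Plane}

/-! ### The thermostat curvature -/

theorem hasFDerivAt_rotVec (v : UnitTangent Γ) :
    HasFDerivAt (fun h : TanVec => rotVec (v + cover Γ h).2)
      ((ContinuousLinearMap.snd ℝ Plane ℝ).smulRight (-unitVec v.2)) 0 := by
  obtain ⟨x, θ⟩ := v
  induction θ using Real.Angle.induction_on with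
  | _ θ =>
  have h1 : ∀ h : TanVec, rotVec ((x, (θ : Real.Angle)) + cover Γ h : UnitTangent Γ).2
      = !₂[-Real.sin (θ + h.2), Real.cos (θ + h.2)] := by
    intro h
    simp [rotVec, cover, ← Real.Angle.coe_add]
  simp only [h1]
  rw [← hasFDerivWithinAt_univ, hasFDerivWithinAt_euclidean]
  intro i
  rw [hasFDerivWithinAt_univ]
  have h2 : HasFDerivAt (fun h : TanVec => θ + h.2) (ContinuousLinearMap.snd ℝ Plane ℝ) 0 :=
    (hasFDerivAt_snd).const_add θ
  fin_cases i
  · refine (h2.sin.neg).congr_fderiv ?_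
    ext <;> simp [unitVec]
  · refine (h2.cos).congr_fderiv ?_
    ext <;> simp [unitVec]

theorem gaussCurvature_eq_zero (v : UnitTangent Γ) : gaussCurvature v = 0 := by
  have hX := (hasFDerivAt_unitVec v).prodMk (hasFDerivAt_const (0 : ℝ) (0 : TanVec))
  have hH := (hasFDerivAt_rotVec v).prodMk (hasFDerivAt_const (0 : ℝ) (0 : TanVec))
  unfold gaussCurvature bracket VectorField.lieBracket
  simp only [horizontalField_eq, geodesicField]
  rw [hX.fderiv, hH.fderiv]
  simp [coPsi]

theorem dirDeriv_cos (v : UnitTangent Γ) (w : TanVec) :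
    dirDeriv (cosLam Γ) v w = -w.2 * v.2.sin := by
  have h := (EuclideanSpace.proj (𝕜 := ℝ) (0 : Fin 2)).hasFDerivAt.comp (0 : TanVec)
    (hasFDerivAt_unitVec v)
  have e : (fun h : TanVec => cosLam Γ (v + cover Γ h)) =
      (EuclideanSpace.proj (𝕜 := ℝ) (0 : Fin 2)) ∘
        fun h : TanVec => unitVec (v + cover Γ h).2 := by
    ext h; simp [cosLam, unitVec]
  unfold dirDeriv
  rw [e, h.fderiv]
  simp [rotVec]

theorem dirDeriv_neg_sin (v : UnitTangent Γ) (w : TanVec) :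
    dirDeriv (fun u : UnitTangent Γ => -u.2.sin) v w = -w.2 * v.2.cos := by
  have h := (EuclideanSpace.proj (𝕜 := ℝ) (0 : Fin 2)).hasFDerivAt.comp (0 : TanVec)
    (hasFDerivAt_rotVec v)
  have e : (fun h : TanVec => -(v + cover Γ h).2.sin) =
      (EuclideanSpace.proj (𝕜 := ℝ) (0 : Fin 2)) ∘
        fun h : TanVec => rotVec (v + cover Γ h).2 := by
    ext h; simp [rotVec]
  unfold dirDeriv
  rw [e, h.fderiv]
  simp [unitVec]

theorem thermostatCurvature_cosLam (v : UnitTangent Γ) :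
    thermostatCurvature (cosLam Γ) v = 0 := by
  have hV : along verticalField (cosLam Γ) = fun u : UnitTangent Γ => -u.2.sin := by
    ext u; simp [along, dirDeriv_cos, verticalField]
  unfold thermostatCurvature
  rw [gaussCurvature_eq_zero, hV]
  unfold along
  rw [dirDeriv_cos, dirDeriv_neg_sin, horizontalField_eq]
  simp [thermostatField, geodesicField, verticalField, cosLam]
  ring

/-! ### The explicit flow -/

theorem hasDerivAt_planeVec {f g : ℝ → ℝ} {f' g' t : ℝ} (hf : HasDerivAt f f' t)
    (hg : HasDerivAt g g' t) :
    HasDerivAt (fun s => (!₂[f s, g s] : Plane)) !₂[f', g'] t := by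
  rw [hasDerivAt_iff_hasFDerivAt, ← hasFDerivWithinAt_univ, hasFDerivWithinAt_euclidean]
  intro i
  rw [hasFDerivWithinAt_univ]
  fin_cases i
  · refine hf.hasFDerivAt.congr_fderiv ?_
    ext; simp
  · refine hg.hasFDerivAt.congr_fderiv ?_
    ext; simp

/-- The stretching factor `cosh t + sin θ sinh t` of the flow: the inverse of `∂θ_t / ∂θ`. -/
noncomputable def stretch (t : ℝ) (θ : Real.Angle) : ℝ := Real.cosh t + θ.sin * Real.sinh t

/-- The angle by which the direction `θ` turns in time `t`. The tangent half-angle formula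
`tan (δ/2) = cos θ sinh (t/2) / (cosh (t/2) + sin θ sinh (t/2))` has a positive denominator, so it
selects the lift `δ ∈ (-π, π)`, which is smooth in `t` and `θ`. -/
noncomputable def turn (t : ℝ) (θ : Real.Angle) : ℝ :=
  2 * Real.arctan (θ.cos * Real.sinh (t / 2) / stretch (t / 2) θ)

/-- The displacement, in the universal cover, of a point of direction `θ` after time `t`. -/
noncomputable def displacement (t : ℝ) (θ : Real.Angle) : TanVec :=
  (!₂[turn t θ, Real.log (stretch t θ)], turn t θ)

/-- The flow of `X + cos θ V` in closed form. -/
noncomputable def explicitFlow (Γ : Submodule ℤ Plane) (t : ℝ) (v : UnitTangent Γ) :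
    UnitTangent Γ :=
  v + cover Γ (displacement t v.2)

theorem stretch_pos (t : ℝ) (θ : Real.Angle) : 0 < stretch t θ := by
  have h1 := θ.cos_sq_add_sin_sq
  have h2 := Real.cosh_sq t
  have h3 := Real.cosh_pos t
  unfold stretch
  by_contra! h
  nlinarith [sq_nonneg (θ.cos), sq_nonneg (θ.cos * Real.sinh t),
    sq_nonneg (θ.sin * Real.sinh t)]

/-- In the half-angle substitution, the sum of the squares of the numerator and the denominator of
`tan (δ/2)` is `stretch t θ`. -/
theorem stretch_half_sq (t : ℝ) (θ : Real.Angle) :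
    stretch (t / 2) θ ^ 2 + (θ.cos * Real.sinh (t / 2)) ^ 2 = stretch t θ := by
  have h1 := θ.cos_sq_add_sin_sq
  have h2 := Real.cosh_sq (t / 2)
  have h3 : Real.cosh t = Real.cosh (t / 2) ^ 2 + Real.sinh (t / 2) ^ 2 := by
    rw [← Real.cosh_two_mul]; ring_nf
  have h4 : Real.sinh t = 2 * Real.sinh (t / 2) * Real.cosh (t / 2) := by
    rw [← Real.sinh_two_mul]; ring_nf
  unfold stretch
  rw [h3, h4]
  linear_combination Real.sinh (t / 2) ^ 2 * h1

theorem cos_two_mul_arctan_div (a b : ℝ) (hb : 0 < b) :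
    Real.cos (2 * Real.arctan (a / b)) = (b ^ 2 - a ^ 2) / (b ^ 2 + a ^ 2) := by
  have : 0 < b ^ 2 + a ^ 2 := by positivity
  rw [Real.cos_two_mul, Real.cos_sq_arctan]
  field_simp
  ring

theorem sin_two_mul_arctan_div (a b : ℝ) (hb : 0 < b) :
    Real.sin (2 * Real.arctan (a / b)) = 2 * a * b / (b ^ 2 + a ^ 2) := by
  have h : 0 < b ^ 2 + a ^ 2 := by positivity
  have hc := (Real.cos_arctan_pos (a / b)).ne'
  have e : Real.sin (Real.arctan (a / b)) = a / b * Real.cos (Real.arctan (a / b)) := by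
    rw [← div_eq_iff hc, ← Real.tan_eq_sin_div_cos, Real.tan_arctan]
  rw [Real.sin_two_mul, e, show 2 * (a / b * Real.cos (Real.arctan (a / b))) *
    Real.cos (Real.arctan (a / b)) = 2 * (a / b) * Real.cos (Real.arctan (a / b)) ^ 2 by ring,
    Real.cos_sq_arctan]
  field_simp

theorem cos_add_turn (t : ℝ) (θ : Real.Angle) :
    (θ + (turn t θ : Real.Angle)).cos = θ.cos / stretch t θ := by
  have h1 := θ.cos_sq_add_sin_sq
  have h2 := Real.cosh_sq (t / 2)
  rw [Real.Angle.cos_add, Real.Angle.cos_coe, Real.Angle.sin_coe, turn,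
    cos_two_mul_arctan_div _ _ (stretch_pos _ _), sin_two_mul_arctan_div _ _ (stretch_pos _ _),
    stretch_half_sq]
  have := stretch_pos t θ
  field_simp
  unfold stretch
  linear_combination θ.cos * h2 - θ.cos * Real.sinh (t / 2) ^ 2 * h1

theorem sin_add_turn (t : ℝ) (θ : Real.Angle) :
    (θ + (turn t θ : Real.Angle)).sin = (Real.sinh t + θ.sin * Real.cosh t) / stretch t θ := by
  have h1 := θ.cos_sq_add_sin_sq
  have h3 : Real.cosh t = Real.cosh (t / 2) ^ 2 + Real.sinh (t / 2) ^ 2 := by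
    rw [← Real.cosh_two_mul]; ring_nf
  have h4 : Real.sinh t = 2 * Real.sinh (t / 2) * Real.cosh (t / 2) := by
    rw [← Real.sinh_two_mul]; ring_nf
  rw [Real.Angle.sin_add, Real.Angle.cos_coe, Real.Angle.sin_coe, turn,
    cos_two_mul_arctan_div _ _ (stretch_pos _ _), sin_two_mul_arctan_div _ _ (stretch_pos _ _),
    stretch_half_sq]
  have := stretch_pos t θ
  field_simp
  unfold stretch
  rw [h3, h4]
  linear_combination (θ.sin * Real.sinh (t / 2) ^ 2 +
    2 * Real.sinh (t / 2) * Real.cosh (t / 2)) * h1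

theorem hasDerivAt_stretch (t : ℝ) (θ : Real.Angle) :
    HasDerivAt (fun s => stretch s θ) (Real.sinh t + θ.sin * Real.cosh t) t :=
  (Real.hasDerivAt_cosh t).add ((Real.hasDerivAt_sinh t).const_mul _)

theorem hasDerivAt_turn (t : ℝ) (θ : Real.Angle) :
    HasDerivAt (fun s => turn s θ) (θ.cos / stretch t θ) t := by
  have hh : HasDerivAt (fun s : ℝ => s / 2) (1 / 2) t := (hasDerivAt_id t).div_const 2
  have hs := (hasDerivAt_stretch (t / 2) θ).comp t hh
  have hn := (((Real.hasDerivAt_sinh (t / 2)).comp t hh).const_mul θ.cos)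
  have hE := stretch_pos (t / 2) θ
  have hD := stretch_pos t θ
  refine ((hn.div hs hE.ne').arctan.const_mul 2).congr_deriv ?_
  have h2 := Real.cosh_sq (t / 2)
  have h5 := stretch_half_sq t θ
  simp only [Function.comp, Pi.div_apply]
  rw [← h5]
  have h6 : stretch (t / 2) θ ^ 2 + (θ.cos * Real.sinh (t / 2)) ^ 2 ≠ 0 := by positivity
  have h7 : 1 + (θ.cos * Real.sinh (t / 2) / stretch (t / 2) θ) ^ 2 ≠ 0 := by positivity
  field_simp
  unfold stretch
  linear_combination θ.cos * h2

theorem hasDerivAt_displacement (t : ℝ) (v : UnitTangent Γ) :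
    HasDerivAt (fun s => displacement s v.2)
      (thermostatField (cosLam Γ) (explicitFlow Γ t v)) t := by
  have h1 := hasDerivAt_turn t v.2
  have h2 := (hasDerivAt_stretch t v.2).log (stretch_pos t v.2).ne'
  refine ((hasDerivAt_planeVec h1 h2).prodMk h1).congr_deriv ?_
  have e : (explicitFlow Γ t v).2 = v.2 + (turn t v.2 : Real.Angle) := rfl
  simp only [thermostatField, geodesicField, verticalField, cosLam, unitVec, e, cos_add_turn,
    sin_add_turn]
  simp

theorem cover_add (g h : TanVec) : cover Γ (g + h) = cover Γ g + cover Γ h := by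
  simp [cover]

theorem cover_sub (g h : TanVec) : cover Γ (g - h) = cover Γ g - cover Γ h := by
  simp [cover]

theorem cover_surjective : Function.Surjective (cover Γ) := by
  rintro ⟨x, θ⟩
  obtain ⟨y, rfl⟩ := Submodule.Quotient.mk_surjective _ x
  induction θ using Real.Angle.induction_on with
  | _ θ => exact ⟨(y, θ), rfl⟩

theorem displacement_zero (θ : Real.Angle) : displacement 0 θ = 0 := by
  ext i
  · fin_cases i <;> simp [displacement, turn, stretch]
  · simp [displacement, turn]

theorem isFlow_explicitFlow : IsFlow (thermostatField (cosLam Γ)) (explicitFlow Γ) := by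
  intro v
  constructor
  · simp [explicitFlow, displacement_zero, cover]
  · obtain ⟨p, hp⟩ := cover_surjective v
    refine ⟨fun t => p + displacement t v.2, fun t => ?_, fun t => ?_⟩
    · rw [cover_add, hp]; rfl
    · exact (hasDerivAt_displacement t v).const_add p

/-- The lift of the thermostat field to the universal cover is Lipschitz. -/
theorem lipschitzWith_lift :
    LipschitzWith 2 (fun h : TanVec => ((!₂[Real.cos h.2, Real.sin h.2], Real.cos h.2) : TanVec)) := by
  have hc : LipschitzWith 1 (fun h : TanVec => Real.cos h.2) := by
    simpa using! Real.lipschitzWith_cos.comp (LipschitzWith.prod_snd (α := Plane) (β := ℝ))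
  have hs : LipschitzWith 1 (fun h : TanVec => Real.sin h.2) := by
    simpa using! Real.lipschitzWith_sin.comp (LipschitzWith.prod_snd (α := Plane) (β := ℝ))
  refine LipschitzWith.of_dist_le_mul fun g h => ?_
  have h1 := hc.dist_le_mul g h
  have h2 := hs.dist_le_mul g h
  simp only [NNReal.coe_one, one_mul] at h1 h2
  rw [Prod.dist_eq, max_le_iff]
  refine ⟨?_, ?_⟩
  · rw [EuclideanSpace.dist_eq, Fin.sum_univ_two]
    refine Real.sqrt_le_iff.mpr ⟨by positivity, ?_⟩
    simp only [Matrix.cons_val_zero, Matrix.cons_val_one, NNReal.coe_ofNat]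
    nlinarith [dist_nonneg (x := Real.cos g.2) (y := Real.cos h.2),
      dist_nonneg (x := Real.sin g.2) (y := Real.sin h.2), dist_nonneg (x := g) (y := h)]
  · simp only [NNReal.coe_ofNat]
    linarith [dist_nonneg (x := g) (y := h)]

theorem thermostatField_cover (h : TanVec) : thermostatField (cosLam Γ) (cover Γ h) =
    (!₂[Real.cos h.2, Real.sin h.2], Real.cos h.2) := by
  simp [thermostatField, geodesicField, verticalField, cosLam, unitVec, cover]

theorem IsIntegralCurve.unique {γ₁ γ₂ : ℝ → UnitTangent Γ}
    (h₁ : IsIntegralCurve (thermostatField (cosLam Γ)) γ₁)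
    (h₂ : IsIntegralCurve (thermostatField (cosLam Γ)) γ₂) (h0 : γ₁ 0 = γ₂ 0) : γ₁ = γ₂ := by
  obtain ⟨c₁, hc₁, hd₁⟩ := h₁
  obtain ⟨c₂, hc₂, hd₂⟩ := h₂
  have hc₃ : ∀ t, cover Γ (c₂ t + (c₁ 0 - c₂ 0)) = γ₂ t := by
    intro t
    rw [cover_add, cover_sub, hc₁, hc₂, hc₂, h0, sub_self, add_zero]
  -- Two lifts of curves with the same initial point differ at time `0` by a deck transformation;
  -- translating `c₂` by it gives a second solution with the initial value of `c₁`.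
  have key : c₁ = fun t => c₂ t + (c₁ 0 - c₂ 0) := by
    refine ODE_solution_unique_univ (t₀ := 0) (s := fun _ => Set.univ)
      (v := fun _ (h : TanVec) => ((!₂[Real.cos h.2, Real.sin h.2], Real.cos h.2) : TanVec))
      (fun _ => lipschitzWith_lift.lipschitzOnWith) (fun t => ⟨?_, trivial⟩)
      (fun t => ⟨?_, trivial⟩) (by simp)
    · rw [← thermostatField_cover (Γ := Γ), hc₁]; exact hd₁ t
    · rw [← thermostatField_cover (Γ := Γ), hc₃]; exact (hd₂ t).add_const _
  ext1 t
  rw [← hc₁, key, hc₃]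

theorem IsFlow.eq_explicitFlow {φ : ℝ → UnitTangent Γ → UnitTangent Γ}
    (h : IsFlow (thermostatField (cosLam Γ)) φ) : φ = explicitFlow Γ := by
  ext1 t
  ext1 v
  have := (h v).2.unique (isFlow_explicitFlow v).2
    ((h v).1.trans (isFlow_explicitFlow v).1.symm)
  exact congrFun this t

/-! ### The differential of the flow -/

/-- The deck group `Γ × 2πℤ` of the universal covering is discrete. -/
theorem eventually_eq_zero_of_cover_eq_zero [DiscreteTopology Γ] :
    ∀ᶠ h in 𝓝 (0 : TanVec), cover Γ h = 0 → h = 0 := by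
  have h1 : ∀ᶠ y in 𝓝 (0 : Plane), y ∈ Γ → y = 0 := by
    obtain ⟨U, hU, hU'⟩ := isOpen_induced_iff.mp (isOpen_discrete ({0} : Set Γ))
    have h0 : (0 : Plane) ∈ U := by
      have : (0 : Γ) ∈ ((↑) : Γ → Plane) ⁻¹' U := by rw [hU']; rfl
      exact this
    filter_upwards [hU.mem_nhds h0] with y hy hyΓ
    have : (⟨y, hyΓ⟩ : Γ) ∈ ((↑) : Γ → Plane) ⁻¹' U := hy
    rw [hU'] at this
    exact congrArg Subtype.val this
  have h2 : ∀ᶠ s : ℝ in 𝓝 (0 : ℝ), (s : Real.Angle) = ((0 : ℝ) : Real.Angle) → s = 0 := by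
    filter_upwards [Ioo_mem_nhds (neg_lt_zero.mpr Real.pi_pos) Real.pi_pos] with s hs h
    have := Real.Angle.toReal_coe_eq_self_iff.mpr ⟨hs.1, hs.2.le⟩
    rw [← this, h, Real.Angle.coe_zero, Real.Angle.toReal_zero]
  have e1 := (continuous_fst (X := Plane) (Y := ℝ)).tendsto 0
  have e2 := (continuous_snd (X := Plane) (Y := ℝ)).tendsto 0
  filter_upwards [e1.eventually h1, e2.eventually h2] with h k1 k2 hc
  have hc1 := congrArg Prod.fst hc
  have hc2 := congrArg Prod.snd hc
  refine Prod.ext (k1 ?_) (k2 hc2)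
  exact (Submodule.Quotient.mk_eq_zero Γ).mp hc1

/-- Over a discrete group of deck transformations two flat coordinate expressions of the same map
agree near `0`, so that the differential is unique. -/
theorem HasDifferentialAt.unique [DiscreteTopology Γ] {f : UnitTangent Γ → UnitTangent Γ}
    {A B : TanVec →L[ℝ] TanVec} {v : UnitTangent Γ} (hA : HasDifferentialAt f A v)
    (hB : HasDifferentialAt f B v) : A = B := by
  obtain ⟨L, hL0, hL, hLA⟩ := hA
  obtain ⟨M, hM0, hM, hMB⟩ := hB
  have hc : Tendsto (fun h => L h - M h) (𝓝 0) (𝓝 0) := by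
    have := hLA.continuousAt.tendsto.sub hMB.continuousAt.tendsto
    rwa [hL0, hM0, sub_zero] at this
  have e : L =ᶠ[𝓝 0] M := by
    filter_upwards [hL, hM, hc.eventually (eventually_eq_zero_of_cover_eq_zero (Γ := Γ))]
      with h h1 h2 h3
    refine sub_eq_zero.mp (h3 ?_)
    rw [cover_sub, sub_eq_zero]
    exact add_left_cancel (h1.symm.trans h2)
  exact (hLA.congr_of_eventuallyEq e.symm).unique hMB

theorem HasDifferentialAt.differential_eq [DiscreteTopology Γ]
    {f : UnitTangent Γ → UnitTangent Γ} {A : TanVec →L[ℝ] TanVec} {v : UnitTangent Γ}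
    (hA : HasDifferentialAt f A v) : differential f v = A := by
  have h : ∃ A, HasDifferentialAt f A v := ⟨A, hA⟩
  unfold differential
  rw [dif_pos h]
  exact h.choose_spec.unique hA

/-- The derivative of `displacement t θ` with respect to `θ`. -/
noncomputable def displacementDeriv (t : ℝ) (θ : Real.Angle) : TanVec :=
  (!₂[1 / stretch t θ - 1, θ.cos * Real.sinh t / stretch t θ], 1 / stretch t θ - 1)

theorem hasDerivAt_stretch_angle (t θ : ℝ) :
    HasDerivAt (fun s : ℝ => stretch t (s : Real.Angle)) (Real.cos θ * Real.sinh t) θ := by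
  simpa [stretch] using ((Real.hasDerivAt_sin θ).mul_const (Real.sinh t)).const_add (Real.cosh t)

theorem hasDerivAt_turn_angle (t θ : ℝ) :
    HasDerivAt (fun s : ℝ => turn t (s : Real.Angle)) (1 / stretch t (θ : Real.Angle) - 1) θ := by
  have hs := hasDerivAt_stretch_angle (t / 2) θ
  have hn := (Real.hasDerivAt_cos θ).mul_const (Real.sinh (t / 2))
  have hE := stretch_pos (t / 2) θ
  have hD := stretch_pos t θ
  refine ((hn.div hs hE.ne').arctan.const_mul 2).congr_deriv ?_
  have h1 := Real.cos_sq_add_sin_sq θ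
  have h2 := Real.cosh_sq (t / 2)
  have h5 := stretch_half_sq t θ
  simp only [Real.Angle.cos_coe] at h5
  simp only [Pi.div_apply]
  rw [← h5]
  have h6 : stretch (t / 2) θ ^ 2 + (Real.cos θ * Real.sinh (t / 2)) ^ 2 ≠ 0 := by positivity
  have h7 : 1 + (Real.cos θ * Real.sinh (t / 2) / stretch (t / 2) θ) ^ 2 ≠ 0 := by positivity
  field_simp
  simp only [stretch, Real.Angle.sin_coe]
  linear_combination h2 - Real.sinh (t / 2) ^ 2 * h1

theorem hasDerivAt_displacement_angle (t θ : ℝ) :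
    HasDerivAt (fun s : ℝ => displacement t (s : Real.Angle))
      (displacementDeriv t (θ : Real.Angle)) θ := by
  have h1 := hasDerivAt_turn_angle t θ
  have h2 := (hasDerivAt_stretch_angle t θ).log (stretch_pos t θ).ne'
  simpa [displacement, displacementDeriv] using (hasDerivAt_planeVec h1 h2).prodMk h1

/-- The matrix `w ↦ w + w_θ ∂_θ(displacement)` of the differential of the flow in the flat
trivialization. -/
noncomputable def flowDifferential (t : ℝ) (θ : Real.Angle) : TanVec →L[ℝ] TanVec :=
  ContinuousLinearMap.id ℝ TanVec +
    (ContinuousLinearMap.snd ℝ Plane ℝ).smulRight (displacementDeriv t θ)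

theorem hasDifferentialAt_explicitFlow (t : ℝ) (v : UnitTangent Γ) :
    HasDifferentialAt (explicitFlow Γ t) (flowDifferential t v.2) v := by
  obtain ⟨x, θ⟩ := v
  induction θ using Real.Angle.induction_on with
  | _ θ =>
  refine ⟨fun h => h + (displacement t ((θ + h.2 : ℝ) : Real.Angle) -
    displacement t (θ : Real.Angle)), by simp, Eventually.of_forall fun h => ?_, ?_⟩
  · have e : ((x, (θ : Real.Angle)) + cover Γ h : UnitTangent Γ).2 =
        ((θ + h.2 : ℝ) : Real.Angle) := by simp [cover]
    simp only [explicitFlow, e, cover_add, cover_sub]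
    abel
  · have h2 : HasFDerivAt (fun h : TanVec => θ + h.2) (ContinuousLinearMap.snd ℝ Plane ℝ) 0 :=
      (hasFDerivAt_snd).const_add θ
    have h3 := hasDerivAt_displacement_angle t θ
    have h3' : HasDerivAt (fun s : ℝ => displacement t (s : Real.Angle))
      (displacementDeriv t (θ : Real.Angle)) (θ + (0 : TanVec).2) := by simpa using h3
    refine ((hasFDerivAt_id (0 : TanVec)).add
      ((h3'.hasFDerivAt.comp (0 : TanVec) h2).sub_const _)).congr_fderiv ?_
    ext <;> simp [flowDifferential]

theorem inverse_flowDifferential (t : ℝ) (θ : Real.Angle) :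
    (flowDifferential t θ).inverse = ContinuousLinearMap.id ℝ TanVec -
      (ContinuousLinearMap.snd ℝ Plane ℝ).smulRight
        (stretch t θ • displacementDeriv t θ) := by
  have hD := stretch_pos t θ
  have h2 : (displacementDeriv t θ).2 = 1 / stretch t θ - 1 := rfl
  apply ContinuousLinearMap.inverse_eq
  · refine ContinuousLinearMap.ext fun w => ?_
    simp only [flowDifferential, ContinuousLinearMap.comp_apply, add_apply,
      sub_apply, ContinuousLinearMap.smulRight_apply,
      ContinuousLinearMap.id_apply, ContinuousLinearMap.coe_snd', Prod.snd_sub, Prod.smul_snd, h2,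
      smul_eq_mul]
    match_scalars <;> field_simp
    ring
  · refine ContinuousLinearMap.ext fun w => ?_
    simp only [flowDifferential, ContinuousLinearMap.comp_apply, add_apply,
      sub_apply, ContinuousLinearMap.smulRight_apply,
      ContinuousLinearMap.id_apply, ContinuousLinearMap.coe_snd', Prod.snd_add, Prod.smul_snd, h2,
      smul_eq_mul]
    match_scalars <;> field_simp
    ring

/-- The vertical component that `β` loses under the inverse transpose of the flow:
`dφ_t^{-⊤} β = β - vertDefect t θ • ψ`. -/
noncomputable def vertDefect (t : ℝ) (θ : Real.Angle) : ℝ :=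
  θ.sin * (Real.cosh t - 1) + Real.sinh t

theorem invTranspose_explicitFlow_coBeta [DiscreteTopology Γ] (t : ℝ) (v : UnitTangent Γ) :
    invTranspose (explicitFlow Γ t) v (coBeta v) = coBeta v - vertDefect t v.2 • coPsi v := by
  change (coBeta v).comp (differential (explicitFlow Γ t) v).inverse = _
  rw [(hasDifferentialAt_explicitFlow t v).differential_eq, inverse_flowDifferential]
  refine ContinuousLinearMap.ext fun w => ?_
  have hD := stretch_pos t v.2
  have h1 := v.2.cos_sq_add_sin_sq
  have key : coBeta v (stretch t v.2 • displacementDeriv t v.2) = vertDefect t v.2 := by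
    simp [coBeta, displacementDeriv, rotVec, PiLp.inner_apply, Fin.sum_univ_two, vertDefect]
    field_simp
    unfold stretch
    linear_combination Real.sinh t * h1
  rw [ContinuousLinearMap.comp_apply, sub_apply, map_sub,
    ContinuousLinearMap.smulRight_apply, map_smul, key]
  simp [coPsi]
  ring

theorem map_cohorizontal_explicitFlow [DiscreteTopology Γ] (t : ℝ) (v : UnitTangent Γ) :
    (cohorizontal v).map (invTranspose (explicitFlow Γ t) v) =
      line (coBeta v - vertDefect t v.2 • coPsi v) := by
  rw [cohorizontal, line, Submodule.map_span, Set.image_singleton,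
    invTranspose_explicitFlow_coBeta, line]

/-- The defect factors as `2 sinh (t/2)` times the positive number `stretch (t/2) θ`. -/
theorem vertDefect_ne_zero {t : ℝ} (ht : t ≠ 0) (θ : Real.Angle) : vertDefect t θ ≠ 0 := by
  have h3 : Real.cosh t = Real.cosh (t / 2) ^ 2 + Real.sinh (t / 2) ^ 2 := by
    rw [← Real.cosh_two_mul]; ring_nf
  have h4 : Real.sinh t = 2 * Real.sinh (t / 2) * Real.cosh (t / 2) := by
    rw [← Real.sinh_two_mul]; ring_nf
  have h2 := Real.cosh_sq (t / 2)
  have h5 : Real.cosh (t / 2) + θ.sin * Real.sinh (t / 2) ≠ 0 := (stretch_pos (t / 2) θ).ne'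
  have h6 : Real.sinh (t / 2) ≠ 0 := by
    rw [Ne, Real.sinh_eq_zero]; simpa using ht
  have : vertDefect t θ =
      2 * Real.sinh (t / 2) * (Real.cosh (t / 2) + θ.sin * Real.sinh (t / 2)) := by
    unfold vertDefect
    rw [h3, h4]
    linear_combination θ.sin * h2
  rw [this]
  positivity

theorem map_cohorizontal_ne [DiscreteTopology Γ] {t : ℝ} (ht : t ≠ 0) (v : UnitTangent Γ) :
    (cohorizontal v).map (invTranspose (explicitFlow Γ t) v) ≠
      cohorizontal (explicitFlow Γ t v) := by
  intro h
  rw [map_cohorizontal_explicitFlow] at h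
  have hm : coBeta v - vertDefect t v.2 • coPsi v ∈ cohorizontal (explicitFlow Γ t v) := by
    rw [← h]; exact Submodule.mem_span_singleton_self _
  obtain ⟨c, hc⟩ := Submodule.mem_span_singleton.mp hm
  -- Every element of `ℝ β` vanishes on the vertical vector `∂_θ = (0, 1)`.
  have := congrArg (fun ξ : CoVec => ξ (0, 1)) hc
  simp [coBeta, coPsi] at this
  exact vertDefect_ne_zero ht _ this

/-! ### Convergence of lines -/

/-- The projectivization of a normed space is Hausdorff: if `f` is a functional with kernel
containing the line `[x]` but not `[y]`, the continuous function `[w] ↦ |f w| / ‖w‖` separates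
`[x]` from `[y]`. -/
theorem t2Space_projectivization (W : Type*) [NormedAddCommGroup W] [NormedSpace ℝ W]
    [FiniteDimensional ℝ W] : T2Space (ℙ ℝ W) := by
  refine ⟨fun p q hpq => ?_⟩
  induction p using Projectivization.ind with | _ x hx =>
  induction q using Projectivization.ind with | _ y hy =>
  have hxy : y ∉ Submodule.span ℝ {x} := by
    intro h
    obtain ⟨c, hc⟩ := Submodule.mem_span_singleton.mp h
    exact hpq ((Projectivization.mk_eq_mk_iff' ℝ y x hy hx).mpr ⟨c, hc⟩).symm
  obtain ⟨f, hfy, hfx⟩ := Submodule.exists_le_ker_of_notMem hxy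
  have hfx : f x = 0 := hfx (Submodule.mem_span_singleton_self x)
  have hf : Continuous f := f.continuous_of_finiteDimensional
  let F : ℙ ℝ W → ℝ := Quotient.lift (fun w : {w : W // w ≠ 0} => |f w| / ‖(w : W)‖) (by
    rintro ⟨a, ha⟩ ⟨b, hb⟩ ⟨c, hc⟩
    have hc : (c : ℝ) • b = a := hc
    have hc0 : |(c : ℝ)| ≠ 0 := abs_ne_zero.mpr c.ne_zero
    simp only [← hc, map_smul, smul_eq_mul, abs_mul, norm_smul, Real.norm_eq_abs]
    exact mul_div_mul_left _ _ hc0)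
  have hF : Continuous F := by
    refine Continuous.quotient_lift ?_ _
    exact (hf.comp continuous_subtype_val).abs.div (continuous_subtype_val.norm)
      fun w => norm_ne_zero_iff.mpr w.2
  have h1 : F (Projectivization.mk ℝ x hx) = 0 := by
    change |f x| / ‖x‖ = 0
    simp [hfx]
  have h2 : F (Projectivization.mk ℝ y hy) ≠ 0 := by
    change |f y| / ‖y‖ ≠ 0
    simp [hfy, hy]
  have hne : F (Projectivization.mk ℝ x hx) ≠ F (Projectivization.mk ℝ y hy) := by
    rw [h1]; exact h2.symm
  exact separated_by_continuous hF hne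

theorem LinesTendsto.unique {S : Submodule ℝ CoVec} {L : ℝ → Submodule ℝ CoVec}
    {G₁ G₂ : Submodule ℝ CoVec} (h₁ : LinesTendsto S L G₁) (h₂ : LinesTendsto S L G₂) :
    G₁ = G₂ := by
  obtain ⟨l₁, g₁, hl₁, rfl, ht₁⟩ := h₁
  obtain ⟨l₂, g₂, hl₂, rfl, ht₂⟩ := h₂
  have e : l₁ = l₂ := by
    ext1 t
    refine Projectivization.submodule_injective ?_
    exact Submodule.map_injective_of_injective S.injective_subtype ((hl₁ t).trans (hl₂ t).symm)
  have := t2Space_projectivization S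
  rw [e] at ht₁
  rw [tendsto_nhds_unique ht₁ ht₂]

theorem linesTendsto_of_tendsto {S : Submodule ℝ CoVec} {ξ : ℝ → CoVec} {η : CoVec}
    (hS : ∀ t, ξ t ∈ S) (h0 : ∀ t, ξ t ≠ 0) (hηS : η ∈ S) (hη : η ≠ 0)
    (h : Tendsto ξ atTop (𝓝 η)) : LinesTendsto S (fun t => line (ξ t)) (line η) := by
  have hz : ∀ ζ (hζ : ζ ∈ S), ζ ≠ 0 → (⟨ζ, hζ⟩ : S) ≠ 0 := fun ζ hζ h e =>
    h (congrArg Subtype.val e)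
  have hm : ∀ ζ (hζ : ζ ∈ S) (h : ζ ≠ 0),
      (Projectivization.mk ℝ (⟨ζ, hζ⟩ : S) (hz ζ hζ h)).submodule.map S.subtype = line ζ := by
    intro ζ hζ h
    rw [Projectivization.submodule_mk, Submodule.map_span, Set.image_singleton]
    rfl
  refine ⟨fun t => Projectivization.mk ℝ ⟨ξ t, hS t⟩ (hz _ (hS t) (h0 t)),
    Projectivization.mk ℝ ⟨η, hηS⟩ (hz _ hηS hη), fun t => hm _ _ (h0 t), hm _ _ hη, ?_⟩
  have hq : Continuous (fun w : {w : S // w ≠ 0} => (Projectivization.mk ℝ w.1 w.2 : ℙ ℝ S)) :=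
    continuous_quotient_mk'
  have hc : Tendsto (fun t => (⟨⟨ξ t, hS t⟩, hz _ (hS t) (h0 t)⟩ : {w : S // w ≠ 0})) atTop
      (𝓝 ⟨⟨η, hηS⟩, hz _ hηS hη⟩) := by
    rw [tendsto_subtype_rng, tendsto_subtype_rng]
    exact h
  exact (hq.tendsto _).comp hc

theorem linesTendsto_iff_eq_line {S : Submodule ℝ CoVec} {L : ℝ → Submodule ℝ CoVec}
    {ξ : ℝ → CoVec} {η : CoVec} (hL : ∀ t, L t = line (ξ t))
    (hS : ∀ t, ξ t ∈ S) (h0 : ∀ t, ξ t ≠ 0) (hηS : η ∈ S) (hη : η ≠ 0)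
    (h : Tendsto ξ atTop (𝓝 η)) (G : Submodule ℝ CoVec) :
    LinesTendsto S L G ↔ G = line η := by
  have key : LinesTendsto S L (line η) := by
    rw [funext hL]; exact linesTendsto_of_tendsto hS h0 hηS hη h
  exact ⟨fun hG => hG.unique key, fun hG => hG ▸ key⟩

/-! ### The Green bundles over the vertical directions -/

/-- The vertical directions `±π/2` are the zeros of `cos`, hence are preserved by the flow. -/
theorem explicitFlow_snd_of_cos_eq_zero {v : UnitTangent Γ} (hv : v.2.cos = 0) (t : ℝ) :
    (explicitFlow Γ t v).2 = v.2 := by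
  simp [explicitFlow, cover, displacement, turn, hv]

/-- In the coframe, the lines `ℝ(β - d(t) ψ)` converge to `ℝ(a₀ β - b₀ ψ)` as soon as some nonzero
rescaling `a(t) (β - d(t) ψ)` does so coefficientwise. -/
theorem linesTendsto_charSet_iff {v : UnitTangent Γ} (hv : v.2.cos = 0)
    {L : ℝ → Submodule ℝ CoVec} {a d : ℝ → ℝ} {a₀ b₀ : ℝ} {η : CoVec}
    (hL : ∀ t, L t = line (coBeta v - d t • coPsi v)) (ha0 : ∀ t, a t ≠ 0)
    (ha : Tendsto a atTop (𝓝 a₀)) (hb : Tendsto (fun t => a t * d t) atTop (𝓝 b₀))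
    (hη : a₀ • coBeta v - b₀ • coPsi v = η) (hη0 : η ≠ 0) (G : Submodule ℝ CoVec) :
    LinesTendsto (charSet (cosLam Γ) v) L G ↔ G = line η := by
  have hF : thermostatField (cosLam Γ) v = geodesicField v := by
    simp [thermostatField, cosLam, hv]
  obtain ⟨-, ⟨hβX, hβH, -⟩, hψX, hψH, -⟩ := coframe_dual v
  have hS : ∀ p q : ℝ, p • coBeta v - q • coPsi v ∈ charSet (cosLam Γ) v := by
    intro p q
    change (p • coBeta v - q • coPsi v) (thermostatField (cosLam Γ) v) = 0
    simp [hF, hβX, hψX]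
  refine linesTendsto_iff_eq_line (ξ := fun t => a t • coBeta v - (a t * d t) • coPsi v)
    (fun t => ?_) (fun t => hS _ _) (fun t h => ?_) (hη ▸ hS _ _) hη0 ?_ G
  · have e : a t • coBeta v - (a t * d t) • coPsi v = a t • (coBeta v - d t • coPsi v) := by
      module
    rw [hL, line, line, e, Submodule.span_singleton_smul_eq (IsUnit.mk0 _ (ha0 t))]
  · have := congrArg (fun ξ : CoVec => ξ (horizontalField v)) h
    simp [hβH, hψH, ha0 t] at this
  · rw [← hη]
    exact (ha.smul_const _).sub (hb.smul_const _)

/-- A vector `w` killed by `ξ` but not by `η` separates the lines `ℝ ξ` and `ℝ η`. -/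
theorem line_inf_line_eq_bot {ξ η : CoVec} (w : TanVec) (hξ : ξ w = 0) (hη : η w ≠ 0) :
    line ξ ⊓ line η = ⊥ := by
  refine (Submodule.eq_bot_iff _).mpr ?_
  rintro ζ ⟨h1, h2⟩
  obtain ⟨c, hc⟩ := Submodule.mem_span_singleton.mp h1
  obtain ⟨d, hd⟩ := Submodule.mem_span_singleton.mp h2
  have : d * η w = 0 := by
    have := congrArg (fun ξ : CoVec => ξ w) (hd.trans hc.symm)
    simpa [hξ] using this
  rw [← hd, (mul_eq_zero.mp this).resolve_right hη, zero_smul]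

theorem ne_zero_of_apply_vertical {v : UnitTangent Γ} {η : CoVec} (h : η (verticalField v) = 1) : η ≠ 0 := by
  rintro rfl
  simp at h

section

variable [DiscreteTopology Γ] {v : UnitTangent Γ}

theorem isStableGreen_iff (hv : v.2.cos = 0) {a : ℝ → ℝ} {a₀ b₀ : ℝ} {η : CoVec}
    (ha0 : ∀ t, a t ≠ 0) (ha : Tendsto a atTop (𝓝 a₀))
    (hb : Tendsto (fun t => a t * vertDefect (-t) v.2) atTop (𝓝 b₀))
    (hη : a₀ • coBeta v - b₀ • coPsi v = η) (hη0 : η ≠ 0) (G : Submodule ℝ CoVec) :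
    IsStableGreen (cosLam Γ) (explicitFlow Γ) v G ↔ G = line η := by
  refine linesTendsto_charSet_iff hv (fun t => ?_) ha0 ha hb hη hη0 G
  rw [map_cohorizontal_explicitFlow, explicitFlow_snd_of_cos_eq_zero hv]
  simp only [coBeta, coPsi, explicitFlow_snd_of_cos_eq_zero hv]

theorem isUnstableGreen_iff (hv : v.2.cos = 0) {a : ℝ → ℝ} {a₀ b₀ : ℝ} {η : CoVec}
    (ha0 : ∀ t, a t ≠ 0) (ha : Tendsto a atTop (𝓝 a₀))
    (hb : Tendsto (fun t => a t * vertDefect t v.2) atTop (𝓝 b₀))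
    (hη : a₀ • coBeta v - b₀ • coPsi v = η) (hη0 : η ≠ 0) (G : Submodule ℝ CoVec) :
    IsUnstableGreen (cosLam Γ) (explicitFlow Γ) v G ↔ G = line η := by
  refine linesTendsto_charSet_iff hv (fun t => ?_) ha0 ha hb hη hη0 G
  rw [map_cohorizontal_explicitFlow, explicitFlow_snd_of_cos_eq_zero hv]
  simp only [coBeta, coPsi, explicitFlow_snd_of_cos_eq_zero hv]

theorem tendsto_exp_neg_atTop : Tendsto (fun t : ℝ => Real.exp (-t)) atTop (𝓝 0) :=
  Real.tendsto_exp_atBot.comp tendsto_neg_atTop_atBot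

theorem isStableGreen_pos_iff (hc : v.2.cos = 0) (hs : v.2.sin = 1) (G : Submodule ℝ CoVec) :
    IsStableGreen (cosLam Γ) (explicitFlow Γ) v G ↔ G = line (coPsi v + coBeta v) := by
  obtain ⟨-, ⟨-, -, hβ⟩, -, -, hψ⟩ := coframe_dual v
  refine isStableGreen_iff hc (a := fun _ => 1) (a₀ := 1) (b₀ := -1) (by simp) tendsto_const_nhds ?_
    (by module) (ne_zero_of_apply_vertical (v := v) (by simp [hβ, hψ])) G
  have e : ∀ t : ℝ, 1 * vertDefect (-t) v.2 = Real.exp (-t) - 1 := by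
    intro t
    rw [vertDefect, hs, Real.cosh_eq, Real.sinh_eq]; ring
  simpa [e] using tendsto_exp_neg_atTop.sub_const 1

theorem isUnstableGreen_pos_iff (hc : v.2.cos = 0) (hs : v.2.sin = 1) (G : Submodule ℝ CoVec) :
    IsUnstableGreen (cosLam Γ) (explicitFlow Γ) v G ↔ G = line (coPsi v) := by
  obtain ⟨-, -, -, -, hψ⟩ := coframe_dual v
  -- The defect `e^t - 1` blows up, so the covectors are rescaled by `-e^{-t}` to converge to `ψ`.
  refine isUnstableGreen_iff hc (a := fun t => -Real.exp (-t)) (a₀ := 0) (b₀ := -1)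
    (by simp [Real.exp_ne_zero]) (by simpa using tendsto_exp_neg_atTop.neg) ?_
    (by module) (ne_zero_of_apply_vertical (v := v) hψ) G
  have e : ∀ t : ℝ, -Real.exp (-t) * vertDefect t v.2 = Real.exp (-t) - 1 := by
    intro t
    have : Real.exp (-t) * Real.exp t = 1 := by rw [← Real.exp_add]; simp
    rw [vertDefect, hs, Real.cosh_eq, Real.sinh_eq]
    linear_combination -this
  simpa [e] using tendsto_exp_neg_atTop.sub_const 1

theorem isStableGreen_neg_iff (hc : v.2.cos = 0) (hs : v.2.sin = -1) (G : Submodule ℝ CoVec) :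
    IsStableGreen (cosLam Γ) (explicitFlow Γ) v G ↔ G = line (coPsi v) := by
  obtain ⟨-, -, -, -, hψ⟩ := coframe_dual v
  -- The defect `1 - e^t` blows up, so the covectors are rescaled by `e^{-t}` to converge to `ψ`.
  refine isStableGreen_iff hc (a := fun t => Real.exp (-t)) (a₀ := 0) (b₀ := -1)
    (by simp [Real.exp_ne_zero]) tendsto_exp_neg_atTop ?_
    (by module) (ne_zero_of_apply_vertical (v := v) hψ) G
  have e : ∀ t : ℝ, Real.exp (-t) * vertDefect (-t) v.2 = Real.exp (-t) - 1 := by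
    intro t
    have : Real.exp (-t) * Real.exp t = 1 := by rw [← Real.exp_add]; simp
    rw [vertDefect, hs, Real.cosh_eq, Real.sinh_eq, neg_neg]
    linear_combination -this
  simpa [e] using tendsto_exp_neg_atTop.sub_const 1

theorem isUnstableGreen_neg_iff (hc : v.2.cos = 0) (hs : v.2.sin = -1) (G : Submodule ℝ CoVec) :
    IsUnstableGreen (cosLam Γ) (explicitFlow Γ) v G ↔ G = line (coPsi v - coBeta v) := by
  obtain ⟨-, ⟨-, -, hβ⟩, -, -, hψ⟩ := coframe_dual v
  refine isUnstableGreen_iff hc (a := fun _ => -1) (a₀ := -1) (b₀ := -1) (by simp)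
    tendsto_const_nhds ?_ (by module)
    (ne_zero_of_apply_vertical (v := v) (by simp [hβ, hψ])) G
  have e : ∀ t : ℝ, -1 * vertDefect t v.2 = Real.exp (-t) - 1 := by
    intro t
    rw [vertDefect, hs, Real.cosh_eq, Real.sinh_eq]; ring
  simpa [e] using tendsto_exp_neg_atTop.sub_const 1

end

end FlatThermostat

theorem proposition4p1 (Γ : Submodule ℤ Plane) [DiscreteTopology Γ] [IsZLattice ℝ Γ] :
    (∀ v : UnitTangent Γ, thermostatCurvature (cosLam Γ) v = 0) ∧
    (∃! φ : ℝ → UnitTangent Γ → UnitTangent Γ, IsFlow (thermostatField (cosLam Γ)) φ) ∧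
    ∀ φ : ℝ → UnitTangent Γ → UnitTangent Γ, IsFlow (thermostatField (cosLam Γ)) φ →
      (∀ (v : UnitTangent Γ) (t : ℝ), t ≠ 0 →
        (cohorizontal v).map (invTranspose (φ t) v) ≠ cohorizontal (φ t v)) ∧
      ∀ (x : Torus Γ) (vp vm : UnitTangent Γ),
        vp = (x, ((Real.pi / 2 : ℝ) : Real.Angle)) →
        vm = (x, ((-(Real.pi / 2) : ℝ) : Real.Angle)) →
        (∀ G, IsStableGreen (cosLam Γ) φ vp G ↔
          G = line (coPsiLam (cosLam Γ) vp + coBeta vp)) ∧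
        (∀ G, IsUnstableGreen (cosLam Γ) φ vp G ↔ G = line (coPsiLam (cosLam Γ) vp)) ∧
        (∀ G, IsStableGreen (cosLam Γ) φ vm G ↔ G = line (coPsiLam (cosLam Γ) vm)) ∧
        (∀ G, IsUnstableGreen (cosLam Γ) φ vm G ↔
          G = line (coPsiLam (cosLam Γ) vm - coBeta vm)) ∧
        (∀ v, v = vp ∨ v = vm → ∀ Gs Gu, IsStableGreen (cosLam Γ) φ v Gs →
          IsUnstableGreen (cosLam Γ) φ v Gu → Gs ⊓ Gu = ⊥) := by
  refine ⟨thermostatCurvature_cosLam, ⟨explicitFlow Γ, isFlow_explicitFlow,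
    fun φ hφ => hφ.eq_explicitFlow⟩, fun φ hφ => ?_⟩
  obtain rfl := hφ.eq_explicitFlow
  refine ⟨fun v t ht => map_cohorizontal_ne ht v, fun x vp vm hp hm => ?_⟩
  have hpc : vp.2.cos = 0 := by rw [hp, Real.Angle.cos_coe, Real.cos_pi_div_two]
  have hps : vp.2.sin = 1 := by rw [hp, Real.Angle.sin_coe, Real.sin_pi_div_two]
  have hmc : vm.2.cos = 0 := by rw [hm, Real.Angle.cos_coe, Real.cos_neg, Real.cos_pi_div_two]
  have hms : vm.2.sin = -1 := by rw [hm, Real.Angle.sin_coe, Real.sin_neg, Real.sin_pi_div_two]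
  have hpψ : coPsiLam (cosLam Γ) vp = coPsi vp := by simp [coPsiLam, cosLam, hpc]
  have hmψ : coPsiLam (cosLam Γ) vm = coPsi vm := by simp [coPsiLam, cosLam, hmc]
  rw [hpψ, hmψ]
  refine ⟨isStableGreen_pos_iff hpc hps, isUnstableGreen_pos_iff hpc hps,
    isStableGreen_neg_iff hmc hms, isUnstableGreen_neg_iff hmc hms, ?_⟩
  rintro v (rfl | rfl) Gs Gu hGs hGu
  · obtain ⟨-, ⟨-, hβ, -⟩, -, hψ, -⟩ := coframe_dual v
    rw [(isStableGreen_pos_iff hpc hps Gs).mp hGs, (isUnstableGreen_pos_iff hpc hps Gu).mp hGu,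
      inf_comm]
    exact line_inf_line_eq_bot (horizontalField v) hψ (by simp [hβ, hψ])
  · obtain ⟨-, ⟨-, hβ, -⟩, -, hψ, -⟩ := coframe_dual v
    rw [(isStableGreen_neg_iff hmc hms Gs).mp hGs, (isUnstableGreen_neg_iff hmc hms Gu).mp hGu]
    exact line_inf_line_eq_bot (horizontalField v) hψ (by simp [hβ, hψ])
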